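/- Let $p\ge 1$, let $n_1,\dots,n_p\in\mathbb N$, and let $V=\mathbb C^{n_1}\otimes\cdots\otimes\mathbb C^{n_p}$. For each $i$ fix an inner product on $\mathbb R^{n_i}$ and let $\langle\cdot,\cdot\rangle_i$ denote its $\mathbb C$-bilinear extension to $\mathbb C^{n_i}$; let $\langle\cdot,\cdot\rangle$ be the Bombieri–Weyl form on $V$, i.e. the bilinear form with $\langle x_1\otimes\cdots\otimes x_p,\,y_1\otimes\cdots\otimes y_p\rangle=\prod_{i}\langle x_i,y_i\rangle_i$. Orthogonality ($\perp$) refers to these forms. Let $X=\{x_1\otimes\cdots\otimes x_p\}\subseteq V$ be the variety of tensors of rank at most one, $X_{reg}$ its set of regular points, $T_xX$ its tangent space at $x$, and $N_xX=(T_xX)^\perp$ the normal space. A critical rank-one approximation of $T\in V$ is a point $x\in X_{reg}$ with $T-x\in N_xX$ (a critical point on $X_{reg}$ of the squared distance $x\mapsto\langle T-x,T-x\rangle$). Let $\mathrm{DL}_2\subseteq V$ be the closure of the set of all tensors $T$ that have a critical rank-one approximation $x$ with $T-x\in X$. The rank of $T$ is the least $r$ such that $T$ is a sum of $r$ elements of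 $X$; its border rank is the least $r$ such that $T$ is a limit of tensors of rank at most $r$. A tensor $T$ is weakly orthogonally decomposable if $T=\sum_{k=1}^m x_1^k\otimes\cdots\otimes x_p^k$ for some $m$ and some nonzero vectors $x_j^k\in\mathbb C^{n_j}$ with $x_j^k\perp x_j^l$ for all $j$ and all $k\ne l$ (isotropic vectors are allowed). Then: (a) $X\subseteq \mathrm{DL}_2$; (b) every $T\in \mathrm{DL}_2$ has border rank at most $2$; (c) $\mathrm{DL}_2$ contains every weakly orthogonally decomposable tensor of rank at most $2$. -/

import Mathlib

open scoped TensorProduct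

noncomputable section

namespace TensorDL

/-- The differential at `x` of the polynomial function on `V` given by `f`, a polynomial whose
variables are the linear forms on `V` (chain rule: `df_x = ∑ φ, (∂f/∂φ)(x) • φ`). -/
def differentialAt {V : Type*} [AddCommGroup V] [Module ℂ V]
    (f : MvPolynomial (Module.Dual ℂ V) ℂ) (x : V) : Module.Dual ℂ V :=
  ∑ φ ∈ f.vars, MvPolynomial.eval (fun ψ : Module.Dual ℂ V => ψ x) (MvPolynomial.pderiv φ f) • φ

/-- The ideal of all polynomial functions on `V` that vanish on `Z`. -/
def idealOf {V : Type*} [AddCommGroup V] [Module ℂ V] (Z : Set V) :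
    Ideal (MvPolynomial (Module.Dual ℂ V) ℂ) :=
  MvPolynomial.vanishingIdeal ℂ ((fun (z : V) (φ : Module.Dual ℂ V) => φ z) '' Z)

/-- The (Zariski) tangent space at `x` of the algebraic set `Z ⊆ V`: the common kernel of the
differentials at `x` of all polynomial functions vanishing on `Z`. -/
def tangentSpace {V : Type*} [AddCommGroup V] [Module ℂ V] (Z : Set V) (x : V) :
    Submodule ℂ V :=
  ⨅ f ∈ idealOf Z, LinearMap.ker (differentialAt f x)

/-- The regular points of an irreducible algebraic set `Z ⊆ V` (`V` finite-dimensional): the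
points where the dimension of the tangent space takes its minimal value, which is `dim Z`. -/
def regularPoints {V : Type*} [AddCommGroup V] [Module ℂ V] (Z : Set V) : Set V :=
  {x | x ∈ Z ∧ ∀ z ∈ Z,
    Module.finrank ℂ (tangentSpace Z x) ≤ Module.finrank ℂ (tangentSpace Z z)}

/-- The tensor space `ℂ^{n_1} ⊗ … ⊗ ℂ^{n_p}`. Topological notions on it refer to its topology in
Mathlib, which is the usual topology of a finite-dimensional complex vector space. -/
abbrev TensorSpace {p : ℕ} (n : Fin p → ℕ) : Type :=
  ⨂[ℂ] i, (Fin (n i) → ℂ)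

/-- The topology of the tensor space is Hausdorff, hence it is the usual one. -/
theorem t2Space_tensorSpace {p : ℕ} (n : Fin p → ℕ) : T2Space (TensorSpace n) := by
  have key : ∀ x : TensorSpace n, ‖x‖ = 0 → x = 0 := by
    intro x hx
    let b := Basis.piTensorProduct fun i => Pi.basisFun ℂ (Fin (n i))
    apply b.ext_elem
    intro I
    let f : ContinuousMultilinearMap ℂ (fun i => (Fin (n i) → ℂ)) ℂ :=
      (ContinuousMultilinearMap.mkPiAlgebra ℂ (Fin p) ℂ).compContinuousLinearMap
        fun i => ContinuousLinearMap.proj (I i)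
    have h1 : PiTensorProduct.lift f.toMultilinearMap = b.coord I := by
      ext y
      simp [f, b, Basis.piTensorProduct_repr_tprod_apply]
    have h2 := PiTensorProduct.norm_eval_le_projectiveSeminorm f x
    rw [h1, hx, mul_zero] at h2
    simpa using norm_le_zero_iff.1 h2
  have : T0Space (TensorSpace n) := (t0Space_iff_inseparable _).2 fun x y h => by
    rw [Metric.inseparable_iff, dist_eq_norm] at h
    exact sub_eq_zero.1 (key _ h)
  infer_instance

/-- The set `X` of tensors `x_1 ⊗ … ⊗ x_p`, i.e. of rank at most one (the factors may vanish). -/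
def rankOneTensors {p : ℕ} (n : Fin p → ℕ) : Set (TensorSpace n) :=
  Set.range fun x : (i : Fin p) → Fin (n i) → ℂ => PiTensorProduct.tprod ℂ x

/-- The complex bilinear extension to `ℂ^m` of the bilinear form on `ℝ^m` with Gram matrix `G`. -/
def complexForm {m : ℕ} (G : Matrix (Fin m) (Fin m) ℝ) : LinearMap.BilinForm ℂ (Fin m → ℂ) :=
  Matrix.toBilin' (G.map Complex.ofReal)

/-- The Bombieri-Weyl bilinear form on `ℂ^{n_1} ⊗ … ⊗ ℂ^{n_p}`, determined by
`⟨x_1 ⊗ … ⊗ x_p, y_1 ⊗ … ⊗ y_p⟩ = ∏ i, ⟨x_i, y_i⟩_i`. -/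
def bombieriWeyl {p : ℕ} {n : Fin p → ℕ} (G : (i : Fin p) → Matrix (Fin (n i)) (Fin (n i)) ℝ) :
    LinearMap.BilinForm ℂ (TensorSpace n) :=
  PiTensorProduct.dualDistrib ∘ₗ PiTensorProduct.map fun i => complexForm (G i)

theorem bombieriWeyl_tprod {p : ℕ} {n : Fin p → ℕ}
    (G : (i : Fin p) → Matrix (Fin (n i)) (Fin (n i)) ℝ) (x y : (i : Fin p) → Fin (n i) → ℂ) :
    bombieriWeyl G (PiTensorProduct.tprod ℂ x) (PiTensorProduct.tprod ℂ y) =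
      ∏ i, complexForm (G i) (x i) (y i) := by
  simp only [bombieriWeyl, LinearMap.comp_apply, PiTensorProduct.map_tprod]
  exact PiTensorProduct.dualDistrib_apply _ _

/-- The normal space `N_x X` of the rank-one tensors at `x`: the orthogonal complement of the
tangent space with respect to the Bombieri-Weyl form. -/
def normalSpace {p : ℕ} {n : Fin p → ℕ} (G : (i : Fin p) → Matrix (Fin (n i)) (Fin (n i)) ℝ)
    (x : TensorSpace n) : Submodule ℂ (TensorSpace n) :=
  (bombieriWeyl G).orthogonal (tangentSpace (rankOneTensors n) x)

/-- `x` is a critical rank-one approximation of `T`: a regular point of `X` that is critical for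
the squared distance `⟨T - x, T - x⟩` to `T` on `X`, i.e. `T - x ∈ N_x X`. -/
def IsCriticalApprox {p : ℕ} {n : Fin p → ℕ}
    (G : (i : Fin p) → Matrix (Fin (n i)) (Fin (n i)) ℝ) (T x : TensorSpace n) : Prop :=
  x ∈ regularPoints (rankOneTensors n) ∧ T - x ∈ normalSpace G x

/-- `DL_2`: the closure of the set of tensors `T` for which subtracting some critical rank-one
approximation gives a tensor of rank at most one. -/
def DL2 {p : ℕ} {n : Fin p → ℕ} (G : (i : Fin p) → Matrix (Fin (n i)) (Fin (n i)) ℝ) :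
    Set (TensorSpace n) :=
  closure {T | ∃ x, IsCriticalApprox G T x ∧ T - x ∈ rankOneTensors n}

/-- The rank of a tensor: the least `r` such that it is a sum of `r` tensors `x_1 ⊗ … ⊗ x_p`. -/
def tensorRank {p : ℕ} {n : Fin p → ℕ} (T : TensorSpace n) : ℕ :=
  sInf {r | ∃ S : Fin r → TensorSpace n, (∀ k, S k ∈ rankOneTensors n) ∧ T = ∑ k, S k}

/-- The border rank: the least `r` such that `T` is a limit of tensors of rank at most `r`. -/
def borderRank {p : ℕ} {n : Fin p → ℕ} (T : TensorSpace n) : ℕ :=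
  sInf {r | T ∈ closure {S : TensorSpace n | tensorRank S ≤ r}}

/-- `T = ∑ k, x_1^k ⊗ … ⊗ x_p^k` with nonzero (possibly isotropic) vectors such that, for every
factor `j`, the vectors `x_j^k` and `x_j^l` are orthogonal whenever `k ≠ l`. -/
def IsWeaklyOdeco {p : ℕ} {n : Fin p → ℕ}
    (G : (i : Fin p) → Matrix (Fin (n i)) (Fin (n i)) ℝ) (T : TensorSpace n) : Prop :=
  ∃ (m : ℕ) (x : Fin m → (j : Fin p) → Fin (n j) → ℂ),
    (∀ k j, x k j ≠ 0) ∧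
    (∀ k l, k ≠ l → ∀ j, complexForm (G j) (x k j) (x l j) = 0) ∧
    T = ∑ k, PiTensorProduct.tprod ℂ (x k)

end TensorDL

end

noncomputable section

namespace TensorDL

/-! ### Differentials of polynomial functions and tangent spaces -/

section Differential

variable {V : Type*} [AddCommGroup V] [Module ℂ V]

/-! A regular point of `X` approximates itself with remainder `0`, and nonzero points of `X` are
regular because products of linear automorphisms act transitively on them; this gives (a) up to a
limit at `0`. For (b), `T = x + (T - x)` has rank at most two before closure.

For (c), if `x` and `y` are orthogonal in every factor and there are at least two factors, then `y`
is normal to `X` at `x` (`tprod_add_tprod_mem_DL2`). Let `a + b` be weakly odeco, with `a`, `b` of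
rank one. If they are non-proportional in at most one factor, the sum has rank at most one.
Otherwise, let `k`, `l` be two such factors: a quadratic invariant vanishing on odeco tensors forces
orthogonality in every third factor (`orthogonal_of_isWeaklyOdeco`). A third non-proportional factor
then gives orthogonality everywhere. If there is none, factors `k`, `l` carry a two-term matrix that
generically has a complex singular value decomposition, and closedness of `DL2` handles the rest
(`add_mem_of_isClosed`). -/

theorem differentialAt_apply_eq_sum (f : MvPolynomial (Module.Dual ℂ V) ℂ) (x v : V)
    {s : Finset (Module.Dual ℂ V)} (hs : f.vars ⊆ s) :
    differentialAt f x v = ∑ φ ∈ s,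
      MvPolynomial.eval (fun ψ : Module.Dual ℂ V => ψ x) (MvPolynomial.pderiv φ f) * φ v := by
  rw [differentialAt, LinearMap.sum_apply]
  refine (Finset.sum_subset hs fun φ _ hφ => ?_).trans rfl
  simp [MvPolynomial.pderiv_eq_zero_of_notMem_vars hφ]

/-- The differential is the directional derivative. -/
theorem hasDerivAt_eval_line (f : MvPolynomial (Module.Dual ℂ V) ℂ) (x v : V) :
    HasDerivAt (fun t : ℂ => MvPolynomial.eval (fun ψ : Module.Dual ℂ V => ψ (x + t • v)) f)
      (differentialAt f x v) 0 := by
  classical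
  induction f using MvPolynomial.induction_on with
  | C a => simpa [differentialAt] using hasDerivAt_const (0 : ℂ) a
  | add f g hf hg =>
    -- Cancellation can shrink the variables of a sum, so all three differentials are expanded over
    -- one common finite set.
    have hU := differentialAt_apply_eq_sum (f + g) x v
      (s := (f + g).vars ∪ (f.vars ∪ g.vars)) Finset.subset_union_left
    have hfU := differentialAt_apply_eq_sum f x v (s := (f + g).vars ∪ (f.vars ∪ g.vars))
      (Finset.subset_union_left.trans Finset.subset_union_right)
    have hgU := differentialAt_apply_eq_sum g x v (s := (f + g).vars ∪ (f.vars ∪ g.vars))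
      (Finset.subset_union_right.trans Finset.subset_union_right)
    have key : differentialAt (f + g) x v = differentialAt f x v + differentialAt g x v := by
      rw [hU, hfU, hgU, ← Finset.sum_add_distrib]
      simp [add_mul]
    rw [key]
    simp only [RingHom.map_add]
    exact hf.add hg
  | mul_X f φ hf =>
    have hU := differentialAt_apply_eq_sum (f * MvPolynomial.X φ) x v
      (s := (f * MvPolynomial.X φ).vars ∪ (f.vars ∪ {φ})) Finset.subset_union_left
    have hfU := differentialAt_apply_eq_sum f x v
      (s := (f * MvPolynomial.X φ).vars ∪ (f.vars ∪ {φ}))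
      (Finset.subset_union_left.trans Finset.subset_union_right)
    have hmem : φ ∈ (f * MvPolynomial.X φ).vars ∪ (f.vars ∪ {φ}) := by simp
    have key : differentialAt (f * MvPolynomial.X φ) x v = differentialAt f x v * φ x +
        MvPolynomial.eval (fun ψ : Module.Dual ℂ V => ψ x) f * φ v := by
      rw [hU, hfU, Finset.sum_mul, ← Finset.sum_erase_add _ _ hmem,
        ← Finset.sum_erase_add _ _ hmem]
      have : ∀ ψ ∈ Finset.erase ((f * MvPolynomial.X φ).vars ∪ (f.vars ∪ {φ})) φ,
          MvPolynomial.eval (fun ψ : Module.Dual ℂ V => ψ x)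
            (MvPolynomial.pderiv ψ (f * MvPolynomial.X φ)) * ψ v =
          MvPolynomial.eval (fun ψ : Module.Dual ℂ V => ψ x)
            (MvPolynomial.pderiv ψ f) * ψ v * φ x := by
        intro ψ hψ
        rw [Derivation.leibniz, MvPolynomial.pderiv_X_of_ne (Finset.ne_of_mem_erase hψ).symm]
        simp
        ring
      rw [Finset.sum_congr rfl this, Derivation.leibniz, MvPolynomial.pderiv_X_self]
      simp
      ring
    have hφ : HasDerivAt (fun t : ℂ => φ (x + t • v)) (φ v) 0 := by
      simpa using ((hasDerivAt_id (0 : ℂ)).mul_const (φ v)).const_add (φ x)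
    rw [key]
    have h := hf.mul hφ
    simp only [zero_smul, add_zero] at h
    simp only [map_mul, MvPolynomial.eval_X]
    exact h

theorem mem_idealOf_iff {Z : Set V} {f : MvPolynomial (Module.Dual ℂ V) ℂ} :
    f ∈ idealOf Z ↔ ∀ z ∈ Z, MvPolynomial.eval (fun ψ : Module.Dual ℂ V => ψ z) f = 0 := by
  simp [idealOf, MvPolynomial.mem_vanishingIdeal_iff]

theorem mem_tangentSpace_iff {Z : Set V} {x v : V} :
    v ∈ tangentSpace Z x ↔ ∀ f ∈ idealOf Z, differentialAt f x v = 0 := by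
  simp [tangentSpace, Submodule.mem_iInf]

/-- If `f` vanishes on `Z`, so does `f ∘ e`; both have the same derivative along corresponding
lines. -/
theorem map_mem_tangentSpace {Z : Set V} (e : V →ₗ[ℂ] V) (he : ∀ z ∈ Z, e z ∈ Z) {x v : V}
    (hv : v ∈ tangentSpace Z x) : e v ∈ tangentSpace Z (e x) := by
  rw [mem_tangentSpace_iff] at hv ⊢
  intro f hf
  rw [mem_idealOf_iff] at hf
  have h := hv (MvPolynomial.rename (fun φ : Module.Dual ℂ V => φ ∘ₗ e) f)
    (mem_idealOf_iff.2 fun z hz => by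
      rw [MvPolynomial.eval_rename]
      exact hf _ (he z hz))
  have h1 := hasDerivAt_eval_line (MvPolynomial.rename (fun φ : Module.Dual ℂ V => φ ∘ₗ e) f) x v
  have h2 := hasDerivAt_eval_line f (e x) (e v)
  rw [h] at h1
  refine h2.unique ?_
  have : (fun t : ℂ => MvPolynomial.eval (fun ψ : Module.Dual ℂ V => ψ (e x + t • e v)) f) =
      fun t => MvPolynomial.eval (fun ψ : Module.Dual ℂ V => ψ (x + t • v))
        (MvPolynomial.rename (fun φ : Module.Dual ℂ V => φ ∘ₗ e) f) := by
    ext t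
    rw [MvPolynomial.eval_rename]
    simp [Function.comp_def]
  rw [this]
  exact h1

theorem subset_tangentSpace_zero {Z : Set V} (hZ : ∀ (t : ℂ), ∀ z ∈ Z, t • z ∈ Z) :
    Z ⊆ tangentSpace Z 0 := by
  intro v hv
  rw [SetLike.mem_coe, mem_tangentSpace_iff]
  intro f hf
  rw [mem_idealOf_iff] at hf
  refine (hasDerivAt_eval_line f 0 v).unique ?_
  have : (fun t : ℂ => MvPolynomial.eval (fun ψ : Module.Dual ℂ V => ψ (0 + t • v)) f) =
      fun _ => 0 := by
    ext t
    rw [zero_add]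
    exact hf _ (hZ t v hv)
  rw [this]
  exact hasDerivAt_const _ _

/-- If `α β = γ δ` on `Z` and `β x = 1`, `α x = γ x = δ x = 0`, then `α` vanishes on the tangent
space at `x`. -/
theorem apply_eq_zero_of_mem_tangentSpace {Z : Set V} {x v : V} (hv : v ∈ tangentSpace Z x)
    {α β γ δ : Module.Dual ℂ V} (h : ∀ z ∈ Z, α z * β z = γ z * δ z) (hα : α x = 0)
    (hβ : β x = 1) (hγ : γ x = 0) (hδ : δ x = 0) : α v = 0 := by
  rw [mem_tangentSpace_iff] at hv
  have h0 := hv (MvPolynomial.X α * MvPolynomial.X β - MvPolynomial.X γ * MvPolynomial.X δ)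
    (mem_idealOf_iff.2 fun z hz => by simp [h z hz])
  have h1 := hasDerivAt_eval_line
    (MvPolynomial.X α * MvPolynomial.X β - MvPolynomial.X γ * MvPolynomial.X δ) x v
  rw [h0] at h1
  have hd : ∀ φ : Module.Dual ℂ V, HasDerivAt (fun t : ℂ => φ (x + t • v)) (φ v) 0 := fun φ => by
    simpa using ((hasDerivAt_id (0 : ℂ)).mul_const (φ v)).const_add (φ x)
  have h2 := ((hd α).mul (hd β)).sub ((hd γ).mul (hd δ))
  have h3 := h2.unique (by simpa [Pi.mul_def, Pi.sub_def] using h1)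
  simpa [hα, hβ, hγ, hδ] using h3

end Differential

/-! ### Regular points, normal vectors and rank -/

section RankOne

variable {p : ℕ} {n : Fin p → ℕ}

theorem smul_mem_rankOneTensors (hp : 1 ≤ p) (t : ℂ) {z : TensorSpace n}
    (hz : z ∈ rankOneTensors n) : t • z ∈ rankOneTensors n := by
  obtain ⟨x, rfl⟩ := hz
  refine ⟨Function.update x ⟨0, hp⟩ (t • x ⟨0, hp⟩), ?_⟩
  change PiTensorProduct.tprod ℂ _ = _
  rw [MultilinearMap.map_update_smul, Function.update_eq_self]

theorem zero_mem_rankOneTensors (hp : 1 ≤ p) : (0 : TensorSpace n) ∈ rankOneTensors n := by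
  simpa using smul_mem_rankOneTensors hp 0 (Set.mem_range_self (0 : (i : Fin p) → Fin (n i) → ℂ))

theorem factor_ne_zero {x : (i : Fin p) → Fin (n i) → ℂ} (hx : PiTensorProduct.tprod ℂ x ≠ 0)
    (i : Fin p) : x i ≠ 0 := fun h => hx ((PiTensorProduct.tprod ℂ).map_coord_zero i h)

/-- At `0` the tangent space contains the cone `X`, which spans everything. Any two nonzero points
are related by a product of automorphisms preserving `X`. -/
theorem mem_regularPoints_of_ne_zero (hp : 1 ≤ p) {x : TensorSpace n}
    (hx : x ∈ rankOneTensors n) (hx0 : x ≠ 0) : x ∈ regularPoints (rankOneTensors n) := by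
  refine ⟨hx, fun z hz => ?_⟩
  rcases eq_or_ne z 0 with rfl | hz0
  · have : tangentSpace (rankOneTensors n) 0 = ⊤ := by
      rw [eq_top_iff, ← PiTensorProduct.span_tprod_eq_top, Submodule.span_le]
      exact subset_tangentSpace_zero fun t z hz => smul_mem_rankOneTensors hp t hz
    rw [this, finrank_top]
    exact Submodule.finrank_le _
  · obtain ⟨x, rfl⟩ := hx
    obtain ⟨z, rfl⟩ := hz
    choose A hA using fun i => SeparatingDual.exists_continuousLinearEquiv_apply_eq (R := ℂ)
      (factor_ne_zero hx0 i) (factor_ne_zero hz0 i)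
    let e := PiTensorProduct.congr fun i => (A i).toLinearEquiv
    have he : e (PiTensorProduct.tprod ℂ x) = PiTensorProduct.tprod ℂ z := by
      simp [e, PiTensorProduct.congr_tprod, hA]
    rw [← LinearEquiv.finrank_map_eq e]
    refine Submodule.finrank_mono ?_
    rintro _ ⟨v, hv, rfl⟩
    change _ ∈ tangentSpace _ (PiTensorProduct.tprod ℂ z)
    rw [← he]
    refine map_mem_tangentSpace e.toLinearMap ?_ hv
    rintro _ ⟨y, rfl⟩
    exact ⟨_, (PiTensorProduct.congr_tprod _ y).symm⟩

variable {G : (i : Fin p) → Matrix (Fin (n i)) (Fin (n i)) ℝ}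

theorem regularPoints_subset_DL2 (hp : 1 ≤ p) :
    regularPoints (rankOneTensors n) ⊆ DL2 G := fun x hx =>
  subset_closure ⟨x, ⟨hx, by simp⟩, by simpa using zero_mem_rankOneTensors hp⟩

theorem rankOneTensors_subset_DL2 (hp : 1 ≤ p) : rankOneTensors n ⊆ DL2 G := by
  intro x hx
  rcases eq_or_ne x 0 with rfl | hx0
  · by_cases h : ∃ y ∈ rankOneTensors n, y ≠ 0
    · obtain ⟨y, hy, hy0⟩ := h
      have hlim : Filter.Tendsto (fun t : ℂ => t • y) (nhdsWithin 0 {0}ᶜ) (nhds 0) := by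
        have : Continuous fun t : ℂ => t • y := by fun_prop
        simpa using (this.tendsto 0).mono_left nhdsWithin_le_nhds
      refine isClosed_closure.mem_of_tendsto hlim ?_
      filter_upwards [self_mem_nhdsWithin] with t ht
      exact regularPoints_subset_DL2 hp (mem_regularPoints_of_ne_zero hp
        (smul_mem_rankOneTensors hp t hy) (smul_ne_zero ht hy0))
    · push Not at h
      exact regularPoints_subset_DL2 hp ⟨hx, fun z hz => by rw [h z hz]⟩
  · exact regularPoints_subset_DL2 hp (mem_regularPoints_of_ne_zero hp hx hx0)

theorem complexForm_comm {m : ℕ} {H : Matrix (Fin m) (Fin m) ℝ} (hH : H.PosDef)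
    (x y : Fin m → ℂ) : complexForm H x y = complexForm H y x := by
  simp only [complexForm, Matrix.toBilin'_apply, Matrix.map_apply]
  rw [Finset.sum_comm]
  refine Finset.sum_congr rfl fun i _ => Finset.sum_congr rfl fun j _ => ?_
  have : H j i = H i j := by simpa using hH.isHermitian.apply i j
  rw [this]
  ring

theorem exists_complexForm_self_ne_zero {m : ℕ} {H : Matrix (Fin m) (Fin m) ℝ} (hH : H.PosDef)
    (i : Fin m) : ∃ e, complexForm H e e ≠ 0 :=
  ⟨Pi.single i 1, by
    have := hH.diag_pos (i := i)
    simp [complexForm, this.ne']⟩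

/-- A pair of factorwise orthogonal rank-one tensors. -/
theorem tprod_add_tprod_mem_DL2 {i₀ i₁ : Fin p} (hi : i₀ ≠ i₁)
    (x y : (i : Fin p) → Fin (n i) → ℂ) (hxy : ∀ i, complexForm (G i) (x i) (y i) = 0) :
    PiTensorProduct.tprod ℂ x + PiTensorProduct.tprod ℂ y ∈ DL2 G := by
  have hp : 1 ≤ p := by have := i₀.2; omega
  by_cases hx0 : PiTensorProduct.tprod ℂ x = 0
  · rw [hx0, zero_add]
    exact rankOneTensors_subset_DL2 hp ⟨y, rfl⟩
  refine subset_closure ⟨PiTensorProduct.tprod ℂ x,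
    ⟨mem_regularPoints_of_ne_zero hp ⟨x, rfl⟩ hx0, ?_⟩, by simp [rankOneTensors]⟩
  rw [add_sub_cancel_left, normalSpace, LinearMap.BilinForm.mem_orthogonal_iff]
  intro v hv
  choose φ hφ using fun i => SeparatingDual.exists_eq_one (R := ℂ) (factor_ne_zero hx0 i)
  let ψ : (i : Fin p) → Module.Dual ℂ (Fin (n i) → ℂ) := fun i => (complexForm (G i)).flip (y i)
  let Φ : (i : Fin p) → Module.Dual ℂ (Fin (n i) → ℂ) := fun i => (φ i).toLinearMap
  let D : ((i : Fin p) → Module.Dual ℂ (Fin (n i) → ℂ)) → Module.Dual ℂ (TensorSpace n) :=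
    fun χ => PiTensorProduct.dualDistrib (PiTensorProduct.tprod ℂ χ)
  have hD : ∀ χ s, D χ (PiTensorProduct.tprod ℂ s) = ∏ i, χ i (s i) :=
    fun χ s => PiTensorProduct.dualDistrib_apply χ s
  have hB : (bombieriWeyl G).flip (PiTensorProduct.tprod ℂ y) = D ψ := by
    exact PiTensorProduct.ext (MultilinearMap.ext fun s =>
      (bombieriWeyl_tprod G s y).trans (hD ψ s).symm)
  have hψx : ∀ i, ψ i (x i) = 0 := hxy
  suffices h : D ψ v = 0 by rwa [← hB] at h
  -- Exchanging slot `i₀` between `D ψ` and `D Φ` gives a quadric containing `X`. At `x`, `γ`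
  -- vanishes through slot `i₀` and `δ` through slot `i₁`.
  refine apply_eq_zero_of_mem_tangentSpace hv (β := D Φ)
    (γ := D (Function.update Φ i₀ (ψ i₀))) (δ := D (Function.update ψ i₀ (Φ i₀))) ?_ ?_ ?_ ?_ ?_
  · rintro _ ⟨s, rfl⟩
    simp only [hD, ← Finset.prod_mul_distrib]
    refine Finset.prod_congr rfl fun i _ => ?_
    rcases eq_or_ne i i₀ with rfl | h
    · simp
    · simp [h, mul_comm]
  · rw [hD]
    exact Finset.prod_eq_zero (Finset.mem_univ i₀) (hψx i₀)
  · rw [hD]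
    exact Finset.prod_eq_one fun i _ => hφ i
  · rw [hD]
    exact Finset.prod_eq_zero (Finset.mem_univ i₀) (by simpa using hψx i₀)
  · rw [hD]
    exact Finset.prod_eq_zero (Finset.mem_univ i₁) (by simpa [hi.symm] using hψx i₁)

/-- `hT` is required because `sInf ∅ = 0`: the rank bound alone would not supply a decomposition. -/
theorem exists_add_of_tensorRank_le_two (hp : 1 ≤ p) {T : TensorSpace n}
    (hT : ∃ (r : ℕ) (S : Fin r → TensorSpace n), (∀ k, S k ∈ rankOneTensors n) ∧ T = ∑ k, S k)
    (h2 : tensorRank T ≤ 2) :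
    ∃ a b : (i : Fin p) → Fin (n i) → ℂ,
      T = PiTensorProduct.tprod ℂ a + PiTensorProduct.tprod ℂ b := by
  obtain ⟨S, hS, hTS⟩ := Nat.sInf_mem hT
  change tensorRank T ≤ 2 at h2
  suffices h : ∀ r ≤ 2, ∀ S : Fin r → TensorSpace n, (∀ k, S k ∈ rankOneTensors n) →
      ∃ A ∈ rankOneTensors n, ∃ B ∈ rankOneTensors n, ∑ k, S k = A + B by
    obtain ⟨_, ⟨a, rfl⟩, _, ⟨b, rfl⟩, h⟩ := h _ h2 S hS
    exact ⟨a, b, hTS.trans h⟩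
  intro r hr S hS
  have h0 := zero_mem_rankOneTensors (n := n) hp
  interval_cases r
  · exact ⟨0, h0, 0, h0, by simp⟩
  · exact ⟨S 0, hS 0, 0, h0, by simp⟩
  · exact ⟨S 0, hS 0, S 1, hS 1, by simp [Fin.sum_univ_two]⟩

theorem borderRank_le_two {T : TensorSpace n} (hT : T ∈ DL2 G) : borderRank T ≤ 2 := by
  refine Nat.sInf_le (closure_mono ?_ hT)
  rintro S ⟨x, hx, hS⟩
  refine Nat.sInf_le ⟨![x, S - x], ?_, by simp⟩
  intro k
  fin_cases k
  · exact hx.1.1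
  · exact hS

end RankOne

/-! ### Complex singular value decomposition of two-term tensors -/

section PlaneSVD

/-- Over `ℂ`, `P X² + S X Y + R Y²` splits as `(α X + β Y)(γ X + δ Y)`, with independent factors
when the discriminant is nonzero. -/
theorem exists_factor_binary_quadratic {P S R : ℂ} (h : S ^ 2 - 4 * P * R ≠ 0) :
    ∃ α β γ δ : ℂ, α * γ = P ∧ β * δ = R ∧ α * δ + β * γ = S ∧ α * δ - β * γ ≠ 0 := by
  by_cases hP : P = 0
  · subst hP
    exact ⟨0, 1, S, R, by simp, by simp, by simp, by simpa using h⟩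
  · obtain ⟨s, hs⟩ := IsAlgClosed.exists_pow_nat_eq (S ^ 2 - 4 * P * R) two_pos
    refine ⟨P, (S - s) / 2, 1, (S + s) / (2 * P), by simp, ?_, by field_simp; ring, ?_⟩
    · field_simp
      linear_combination -hs
    · rintro h0
      have : s = 0 := by
        field_simp at h0
        linear_combination h0 / 2
      simp [this] at hs
      exact h hs.symm

variable {V W E : Type*} [AddCommGroup V] [Module ℂ V] [AddCommGroup W] [Module ℂ W]
  [AddCommGroup E] [Module ℂ E]

/-- The quantity whose nonvanishing guarantees that `a ⊗ c + b ⊗ d` has a complex singular value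
decomposition. -/
def planeDisc (g : LinearMap.BilinForm ℂ V) (h : LinearMap.BilinForm ℂ W) (a b : V) (c d : W) :
    ℂ :=
  (g a a * h c c - g b b * h d d) ^ 2 +
    4 * (g a b * h c c + g b b * h c d) * (g a a * h c d + g a b * h d d)

/-- A base change of `a, b` with the dual change of `c, d` preserves the tensor. Both orthogonality
conditions are linear in the coefficients `(P, S, R)` of the product of the two linear forms, so
their cross product solves them; `planeDisc` is its discriminant. -/
theorem exists_orthogonal_decomposition (N : V →ₗ[ℂ] W →ₗ[ℂ] E) {g : LinearMap.BilinForm ℂ V}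
    {h : LinearMap.BilinForm ℂ W} (hg : ∀ x y, g x y = g y x) (hh : ∀ x y, h x y = h y x)
    {a b : V} {c d : W} (hD : planeDisc g h a b c d ≠ 0) :
    ∃ u w v z, g u w = 0 ∧ h v z = 0 ∧ N u v + N w z = N a c + N b d := by
  obtain ⟨α, β, γ, δ, hP, hR, hS, hne⟩ := exists_factor_binary_quadratic
    (P := -(g a b * h c c + g b b * h c d)) (S := g a a * h c c - g b b * h d d)
    (R := g a a * h c d + g a b * h d d) (by
      intro h0
      apply hD
      rw [planeDisc]
      linear_combination h0)
  refine ⟨(α * δ - β * γ)⁻¹ • (α • a + β • b), γ • a + δ • b,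
    δ • c - γ • d, (α * δ - β * γ)⁻¹ • (α • d - β • c), ?_, ?_, ?_⟩
  · simp only [map_smul, map_add, LinearMap.smul_apply, LinearMap.add_apply, smul_eq_mul,
      hg b a]
    linear_combination (α * δ - β * γ)⁻¹ * (g a a * hP + g a b * hS + g b b * hR)
  · simp only [map_smul, map_sub, LinearMap.smul_apply, LinearMap.sub_apply,
      smul_eq_mul, hh d c]
    linear_combination (α * δ - β * γ)⁻¹ * (-h c c * hR + h c d * hS - h d d * hP)
  · have h1 : (α * δ - β * γ)⁻¹ * (α * δ - β * γ) = 1 := inv_mul_cancel₀ hne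
    simp only [map_smul, map_add, map_sub, LinearMap.smul_apply, LinearMap.add_apply]
    generalize (α * δ - β * γ)⁻¹ = ε at h1
    linear_combination (norm := module) h1 • N a c + h1 • N b d

theorem add_mem_of_isClosed [TopologicalSpace E] [ContinuousAdd E] [ContinuousSMul ℂ E]
    (N : V →ₗ[ℂ] W →ₗ[ℂ] E) {g : LinearMap.BilinForm ℂ V} {h : LinearMap.BilinForm ℂ W}
    (hg : ∀ x y, g x y = g y x) (hh : ∀ x y, h x y = h y x)
    (hg0 : ∃ e, g e e ≠ 0) (hh0 : ∃ f, h f f ≠ 0) {S : Set E} (hS : IsClosed S)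
    (hNS : ∀ u w v z, g u w = 0 → h v z = 0 → N u v + N w z ∈ S) (a b : V) (c d : W) :
    N a c + N b d ∈ S := by
  obtain ⟨e, he⟩ := hg0
  obtain ⟨f, hf⟩ := hh0
  -- The segment runs from `(a, b, c, d)` to `(e, 0, f, 0)`, where the discriminant is `(g e e * h f
  -- f) ^ 2`. Being analytic and not identically zero, it is nonzero for small `t ≠ 0`.
  let a' : ℂ → V := fun t => a + t • (e - a)
  let b' : ℂ → V := fun t => b + t • (-b)
  let c' : ℂ → W := fun t => c + t • (f - c)
  let d' : ℂ → W := fun t => d + t • (-d)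
  let D : ℂ → ℂ := fun t => planeDisc g h (a' t) (b' t) (c' t) (d' t)
  have hDan : AnalyticOnNhd ℂ D Set.univ := by
    intro t _
    simp only [D, a', b', c', d', planeDisc, map_add, map_smul, LinearMap.add_apply,
      LinearMap.smul_apply, smul_eq_mul]
    fun_prop
  have hD1 : D 1 ≠ 0 := by
    simp [D, a', b', c', d', planeDisc, he, hf]
  have hD0 : ∀ᶠ t in nhdsWithin (0 : ℂ) {0}ᶜ, D t ≠ 0 := by
    refine (hDan 0 trivial).eventually_eq_zero_or_eventually_ne_zero.resolve_left fun h0 => ?_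
    have := hDan.eq_of_eventuallyEq (g := fun _ => 0) (fun _ _ => analyticAt_const) h0
    exact hD1 (congrFun this 1)
  have hcont : Continuous fun t => N (a' t) (c' t) + N (b' t) (d' t) := by
    simp only [a', b', c', d', map_add, map_smul, LinearMap.add_apply, LinearMap.smul_apply]
    fun_prop
  have hlim : Filter.Tendsto (fun t => N (a' t) (c' t) + N (b' t) (d' t))
      (nhdsWithin (0 : ℂ) {0}ᶜ) (nhds (N a c + N b d)) := by
    simpa [a', b', c', d'] using (hcont.tendsto 0).mono_left nhdsWithin_le_nhds
  refine hS.mem_of_tendsto hlim ?_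
  filter_upwards [hD0] with t ht
  obtain ⟨u, w, v, z, hu, hv, hN⟩ := exists_orthogonal_decomposition N hg hh ht
  exact hN ▸ hNS u w v z hu hv

end PlaneSVD

/-! ### Weakly orthogonally decomposable tensors of rank at most two -/

section Odeco

variable {p : ℕ} {n : Fin p → ℕ}

/-- The tensor product of bilinear forms on the factors. -/
def tensorForm (F : (i : Fin p) → LinearMap.BilinForm ℂ (Fin (n i) → ℂ)) :
    LinearMap.BilinForm ℂ (TensorSpace n) :=
  PiTensorProduct.dualDistrib ∘ₗ PiTensorProduct.map F

theorem tensorForm_tprod (F : (i : Fin p) → LinearMap.BilinForm ℂ (Fin (n i) → ℂ))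
    (x y : (i : Fin p) → Fin (n i) → ℂ) :
    tensorForm F (PiTensorProduct.tprod ℂ x) (PiTensorProduct.tprod ℂ y) =
      ∏ i, F i (x i) (y i) := by
  simp only [tensorForm, LinearMap.comp_apply, PiTensorProduct.map_tprod]
  exact PiTensorProduct.dualDistrib_apply _ _

/-- A form with an alternating factor and a factor for which `T` is orthogonally decomposed
vanishes at `(T, T)`. -/
theorem tensorForm_self_eq_zero {F : (i : Fin p) → LinearMap.BilinForm ℂ (Fin (n i) → ℂ)}
    {G : (i : Fin p) → Matrix (Fin (n i)) (Fin (n i)) ℝ} {T : TensorSpace n}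
    (hT : IsWeaklyOdeco G T) {j k : Fin p} (hj : F j = complexForm (G j))
    (hk : ∀ v, F k v v = 0) : tensorForm F T T = 0 := by
  obtain ⟨m, x, -, hx, rfl⟩ := hT
  simp only [map_sum, LinearMap.sum_apply, tensorForm_tprod]
  refine Finset.sum_eq_zero fun r _ => Finset.sum_eq_zero fun s _ => ?_
  rcases eq_or_ne s r with rfl | hrs
  · exact Finset.prod_eq_zero (Finset.mem_univ k) (hk _)
  · exact Finset.prod_eq_zero (Finset.mem_univ j) (by rw [hj]; exact hx s r hrs j)

theorem exists_dual_ne_zero_eq_zero {m : ℕ} {a b : Fin m → ℂ} (h : ∀ c : ℂ, a ≠ c • b) :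
    ∃ α : Module.Dual ℂ (Fin m → ℂ), α a ≠ 0 ∧ α b = 0 := by
  obtain ⟨α, h1, h2⟩ := Submodule.exists_le_ker_of_notMem (p := Submodule.span ℂ {b}) (v := a)
    (by
      rw [Submodule.mem_span_singleton]
      rintro ⟨c, hc⟩
      exact h c hc.symm)
  exact ⟨α, h1, h2 (Submodule.mem_span_singleton_self b)⟩

/-- Evaluate at `(T, T)` a product form: the given form in slot `j`, an alternating one in slot `k`,
rank-one forms elsewhere. The alternating slot kills the diagonal terms and slot `l` kills `(b, a)`,
leaving `⟨a_j, b_j⟩` times a nonzero scalar. -/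
theorem orthogonal_of_isWeaklyOdeco {G : (i : Fin p) → Matrix (Fin (n i)) (Fin (n i)) ℝ}
    {a b : (i : Fin p) → Fin (n i) → ℂ}
    (hT : IsWeaklyOdeco G (PiTensorProduct.tprod ℂ a + PiTensorProduct.tprod ℂ b))
    (ha : ∀ i, a i ≠ 0) (hb : ∀ i, b i ≠ 0) {j k l : Fin p} (hjk : j ≠ k) (hjl : j ≠ l)
    (hkl : k ≠ l) (hk : ∀ c : ℂ, a k ≠ c • b k) (hl : ∀ c : ℂ, a l ≠ c • b l) :
    complexForm (G j) (a j) (b j) = 0 := by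
  have hα : ∀ i, ∃ α : Module.Dual ℂ (Fin (n i) → ℂ), α (a i) ≠ 0 ∧
      ((∀ c : ℂ, a i ≠ c • b i) → α (b i) = 0) := fun i => by
    by_cases h : ∀ c : ℂ, a i ≠ c • b i
    · obtain ⟨α, h1, h2⟩ := exists_dual_ne_zero_eq_zero h
      exact ⟨α, h1, fun _ => h2⟩
    · obtain ⟨α, h1⟩ := SeparatingDual.exists_eq_one (R := ℂ) (ha i)
      exact ⟨α.toLinearMap, by simp [h1], fun h' => absurd h' h⟩
  choose α hα hα0 using hα
  choose β hβ using fun i => SeparatingDual.exists_eq_one (R := ℂ) (hb i)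
  let L : (i : Fin p) → LinearMap.BilinForm ℂ (Fin (n i) → ℂ) :=
    fun i => LinearMap.BilinForm.linMulLin (α i) (β i).toLinearMap
  have hL : ∀ i x y, L i x y = α i x * β i y := fun i x y => rfl
  let F : (i : Fin p) → LinearMap.BilinForm ℂ (Fin (n i) → ℂ) :=
    fun i => if i = j then complexForm (G i) else if i = k then L i - (L i).flip else L i
  have hFj : F j = complexForm (G j) := by simp [F]
  have hFk : ∀ x y, F k x y = α k x * β k y - α k y * β k x := by
    simp [F, hjk.symm, hL]
  have hFi : ∀ i, i ≠ j → i ≠ k → F i = L i := fun i h1 h2 => by simp [F, h1, h2]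
  have h0 := tensorForm_self_eq_zero hT hFj fun v => by rw [hFk, sub_self]
  have haa : ∏ i, F i (a i) (a i) = 0 :=
    Finset.prod_eq_zero (Finset.mem_univ k) (by rw [hFk, sub_self])
  have hbb : ∏ i, F i (b i) (b i) = 0 :=
    Finset.prod_eq_zero (Finset.mem_univ k) (by rw [hFk, sub_self])
  have hba : ∏ i, F i (b i) (a i) = 0 :=
    Finset.prod_eq_zero (Finset.mem_univ l)
      (by rw [hFi l hjl.symm hkl.symm, hL, hα0 l hl, zero_mul])
  simp only [map_add, LinearMap.add_apply, tensorForm_tprod, haa, hbb, hba, zero_add,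
    add_zero] at h0
  obtain ⟨i, -, hi⟩ := Finset.prod_eq_zero_iff.1 h0
  by_cases hij : i = j
  · subst hij
    rwa [hFj] at hi
  by_cases hik : i = k
  · subst hik
    rw [hFk, hα0 _ hk, zero_mul, sub_zero, hβ, mul_one] at hi
    exact absurd hi (hα _)
  · rw [hFi i hij hik, hL, hβ, mul_one] at hi
    exact absurd hi (hα i)

/-- Two factors of a rank-one tensor as a bilinear function. -/
def twoFactors (b : (i : Fin p) → Fin (n i) → ℂ) {k l : Fin p} (hkl : k ≠ l) :
    (Fin (n k) → ℂ) →ₗ[ℂ] (Fin (n l) → ℂ) →ₗ[ℂ] TensorSpace n :=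
  LinearMap.mk₂ ℂ
    (fun u v => PiTensorProduct.tprod ℂ (Function.update (Function.update b k u) l v))
    (fun u u' v => by
      simp only [Function.update_comm hkl, MultilinearMap.map_update_add])
    (fun c u v => by
      simp only [Function.update_comm hkl, MultilinearMap.map_update_smul])
    (fun u v v' => by simp only [MultilinearMap.map_update_add])
    (fun c u v => by simp only [MultilinearMap.map_update_smul])

theorem twoFactors_apply (b : (i : Fin p) → Fin (n i) → ℂ) {k l : Fin p} (hkl : k ≠ l)
    (u : Fin (n k) → ℂ) (v : Fin (n l) → ℂ) : twoFactors b hkl u v =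
      PiTensorProduct.tprod ℂ (Function.update (Function.update b k u) l v) := rfl

theorem exists_twoFactors_eq_smul {a b : (i : Fin p) → Fin (n i) → ℂ} {k l : Fin p}
    (hkl : k ≠ l) (hab : ∀ i, i ≠ k → i ≠ l → ∃ c : ℂ, a i = c • b i) :
    ∃ C : ℂ, ∀ u v, twoFactors a hkl u v = C • twoFactors b hkl u v := by
  have : ∀ i, ∃ c : ℂ, (i ≠ k → i ≠ l → a i = c • b i) ∧ (i = k ∨ i = l → c = 1) := fun i => by
    by_cases hi : i = k ∨ i = l
    · exact ⟨1, by tauto, by tauto⟩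
    · push Not at hi
      obtain ⟨c, hc⟩ := hab i hi.1 hi.2
      exact ⟨c, fun _ _ => hc, by tauto⟩
  choose c hc hc1 using this
  refine ⟨∏ i, c i, fun u v => ?_⟩
  rw [twoFactors_apply, twoFactors_apply, ← MultilinearMap.map_smul_univ]
  congr 1
  ext1 i
  rcases eq_or_ne i l with rfl | hl
  · simp [hc1 i (Or.inr rfl)]
  rcases eq_or_ne i k with rfl | hk
  · simp [hl, hc1 i (Or.inl rfl)]
  · simp [hk, hl, hc i hk hl]

theorem exists_update_of_proportional {a b : (i : Fin p) → Fin (n i) → ℂ} {k : Fin p}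
    (hab : ∀ i, i ≠ k → ∃ c : ℂ, a i = c • b i) :
    ∃ y, PiTensorProduct.tprod ℂ a = PiTensorProduct.tprod ℂ (Function.update b k y) := by
  have : ∀ i, ∃ c : ℂ, a i = c • Function.update b k (a k) i := fun i => by
    rcases eq_or_ne i k with rfl | hi
    · exact ⟨1, by simp⟩
    · simpa [hi] using hab i hi
  choose c hc using this
  refine ⟨(∏ i, c i) • a k, ?_⟩
  rw [MultilinearMap.map_update_smul, ← MultilinearMap.map_smul_univ]
  exact congrArg _ (funext hc)

theorem isWeaklyOdeco_mem_DL2 (hp : 1 ≤ p) {G : (i : Fin p) → Matrix (Fin (n i)) (Fin (n i)) ℝ}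
    (hG : ∀ i, (G i).PosDef) {a b : (i : Fin p) → Fin (n i) → ℂ}
    (hT : IsWeaklyOdeco G (PiTensorProduct.tprod ℂ a + PiTensorProduct.tprod ℂ b)) :
    PiTensorProduct.tprod ℂ a + PiTensorProduct.tprod ℂ b ∈ DL2 G := by
  by_cases hA : PiTensorProduct.tprod ℂ a = 0
  · rw [hA, zero_add]
    exact rankOneTensors_subset_DL2 hp ⟨b, rfl⟩
  by_cases hB : PiTensorProduct.tprod ℂ b = 0
  · rw [hB, add_zero]
    exact rankOneTensors_subset_DL2 hp ⟨a, rfl⟩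
  have ha := factor_ne_zero hA
  have hb := factor_ne_zero hB
  by_cases hone : ∃ k, ∀ i, i ≠ k → ∃ c : ℂ, a i = c • b i
  · obtain ⟨k, hk⟩ := hone
    obtain ⟨y, hy⟩ := exists_update_of_proportional hk
    refine rankOneTensors_subset_DL2 hp ⟨Function.update b k (y + b k), ?_⟩
    change PiTensorProduct.tprod ℂ _ = _
    rw [MultilinearMap.map_update_add, Function.update_eq_self, hy]
  push Not at hone
  obtain ⟨k, -, hk⟩ := hone ⟨0, hp⟩
  obtain ⟨l, hlk, hl⟩ := hone k
  have horth : ∀ i, i ≠ k → i ≠ l → complexForm (G i) (a i) (b i) = 0 := fun i hik hil =>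
    orthogonal_of_isWeaklyOdeco hT ha hb hik hil hlk.symm hk hl
  by_cases htwo : ∀ i, i ≠ k → i ≠ l → ∃ c : ℂ, a i = c • b i
  · obtain ⟨C, hC⟩ := exists_twoFactors_eq_smul hlk.symm htwo
    have hself : ∀ x : (i : Fin p) → Fin (n i) → ℂ,
        twoFactors x hlk.symm (x k) (x l) = PiTensorProduct.tprod ℂ x := fun x => by
      simp [twoFactors_apply]
    have hC0 : C ≠ 0 := by
      rintro rfl
      apply hA
      rw [← hself, hC, zero_smul]
    have hn : ∀ i, ∃ e, complexForm (G i) e e ≠ 0 := fun i => by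
      obtain ⟨r, -⟩ := Function.ne_iff.1 (ha i)
      exact exists_complexForm_self_ne_zero (hG i) r
    have key := add_mem_of_isClosed (twoFactors b hlk.symm) (complexForm_comm (hG k))
      (complexForm_comm (hG l)) (hn k) (hn l) (S := DL2 G) isClosed_closure
      (fun u w v z huw hvz => by
        -- Moving the scalar `C` restores the factors of `a` in the first term, so `horth` applies
        -- outside `k` and `l`.
        have h1 : twoFactors b hlk.symm u v = twoFactors a hlk.symm (C⁻¹ • u) v := by
          rw [hC, map_smul, LinearMap.smul_apply, smul_inv_smul₀ hC0]
        rw [h1]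
        refine tprod_add_tprod_mem_DL2 hlk _ _ fun i => ?_
        rcases eq_or_ne i l with rfl | hil
        · simpa using hvz
        rcases eq_or_ne i k with rfl | hik
        · simp [hil, huw]
        · simpa [hil, hik] using horth i hik hil) (C • a k) (b k) (a l) (b l)
    rwa [map_smul, LinearMap.smul_apply, ← hC, hself, hself] at key
  · push Not at htwo
    obtain ⟨r, hrk, hrl, hr⟩ := htwo
    -- With three non-proportional factors, any slot is avoided by two of them.
    refine tprod_add_tprod_mem_DL2 hlk _ _ fun i => ?_
    by_cases hik : i = k
    · subst hik
      exact orthogonal_of_isWeaklyOdeco hT ha hb hlk.symm hrk.symm hrl.symm hl hr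
    by_cases hil : i = l
    · subst hil
      exact orthogonal_of_isWeaklyOdeco hT ha hb hlk hrl.symm hrk.symm hk hr
    · exact horth i hik hil

end Odeco

end TensorDL

end

theorem mainTheorem7 {p : ℕ} (hp : 1 ≤ p) (n : Fin p → ℕ)
    (G : (i : Fin p) → Matrix (Fin (n i)) (Fin (n i)) ℝ) (hG : ∀ i, (G i).PosDef) :
    TensorDL.rankOneTensors n ⊆ TensorDL.DL2 G ∧
    (∀ T ∈ TensorDL.DL2 G, TensorDL.borderRank T ≤ 2) ∧
    (∀ T : TensorDL.TensorSpace n,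
      TensorDL.IsWeaklyOdeco G T → TensorDL.tensorRank T ≤ 2 → T ∈ TensorDL.DL2 G) := by
  refine ⟨TensorDL.rankOneTensors_subset_DL2 hp, fun T hT => TensorDL.borderRank_le_two hT,
    fun T hT h2 => ?_⟩
  obtain ⟨m, x, -, -, hx⟩ := id hT
  obtain ⟨a, b, rfl⟩ := TensorDL.exists_add_of_tensorRank_le_two hp
    ⟨m, fun k => PiTensorProduct.tprod ℂ (x k), fun k => ⟨x k, rfl⟩, hx⟩ h2
  exact TensorDL.isWeaklyOdeco_mem_DL2 hp hG hT
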